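/- Let $n\ge 1$ and let $S$ be a finite set. Let $\mathscr{G}_n(S)$ be the set of all choices $\mu$ of a label $\mu\{x,y\}\in\{1,\dots,n\}$ and an orientation $\vec\mu\{x,y\}\in\{(x,y),(y,x)\}$ for each pair $\{x,y\}$ of distinct elements of $S$, partially ordered by letting $\mu\to\nu$ if for each $\{x,y\}$ either $\vec\mu\{x,y\}=\vec\nu\{x,y\}$ and $\mu\{x,y\}\le\nu\{x,y\}$, or $\vec\mu\{x,y\}\ne\vec\nu\{x,y\}$ and $\mu\{x,y\}<\nu\{x,y\}$. Let $\mathscr{K}_n^e(S)\subseteq\mathscr{G}_n(S)$ be the partially ordered subset of those $\mu$ that contain no oriented cycle $x_1\to x_2\to\dots\to x_k\to x_1$ ($k>1$, the $x_j\in S$ distinct) all of whose edges have the same label. A little $n$-cube $c$ is an $n$-tuple of maps $f_i(t)=(1-t)a_i+tb_i$ with $0\le a_i<b_i\le 1$, identified with the embedding $f_1\times\dots\times f_n$ of $I^n$ in itself, where $I=[0,1]$. Let $\mathcal{C}_n(1)$ be the space of little $n$-cubes, topologized as a subspace of $I^{2n}$, and let $\mathcal{C}_n(S)\subseteq \mathcal{C}_n(1)^{S}$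 be the subspace of all families $\langle c_x\rangle_{x\in S}$ with $c_x(\mathrm{int}\,I^n)\cap c_y(\mathrm{int}\,I^n)=\emptyset$ for $x\neq y$. For little cubes $c=\langle f_i\rangle$ and $d=\langle g_i\rangle$ write $c<_i d$ if $f_i(1)\le g_i(0)$. For $\mu\in\mathscr{G}_n(S)$ let $G(\mu)\subseteq\mathcal{C}_n(S)$ be the subspace of all $\langle c_z\rangle$ such that $c_x<_i c_y$ whenever $\mu\{x,y\}=i$ and $\vec\mu\{x,y\}=(x,y)$. Let $\mathit{Top}$ be the category of compactly generated weak Hausdorff spaces, and let $F\colon\mathscr{K}_n^e(S)\to\mathit{Top}$ be the diagram with $$F(\nu)=\bigcup_{\mu\to\nu}G(\mu)\subseteq\mathcal{C}_n(S),$$ where the union is over all morphisms $\mu\to\nu$ in $\mathscr{K}_n^e(S)$, $F(\nu)$ has the subspace topology, and the structure maps are the inclusions. Then: 1. $F$ is Reedy cofibrant: for each $\nu\in\mathscr{K}_n^e(S)$, the canonical map $\operatorname{colim}_{\mu<\nu}F(\mu)\to F(\nu)$, whose domain is the colimit of $F$ over the partially ordered set of all $\mu<\nu$ in $\mathscr{K}_n^e(S)$,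 is a cofibration, that is, it has the homotopy extension property with respect to all spaces. 2. The canonical map $\operatorname{colim}_{\mathscr{K}_n^e(S)}F\to\mathcal{C}_n(S)$ induced by the inclusions $F(\nu)\subseteq\mathcal{C}_n(S)$ is a homeomorphism. -/

import Mathlib

open CategoryTheory CategoryTheory.Limits

universe u

/-! ## Edge labels and orientations of the complete graph on a set -/

/-- The edges of the complete graph on `S`: the unordered pairs of distinct elements. -/
abbrev CompleteEdge (S : Type u) : Type u := {e : Sym2 S // ¬ e.IsDiag}

/-- An object of `𝒢ₙ(S)`: a label and an orientation for each edge of the complete graph on `S`.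
The labels `1, …, n` are represented by the elements of `Fin n`. -/
@[ext]
structure EdgeLabeling (n : ℕ) (S : Type u) where
  /-- the label of an edge -/
  label : CompleteEdge S → Fin n
  /-- the orientation of an edge: one of the two ordered pairs that represent it -/
  orient : CompleteEdge S → S × S
  orient_spec : ∀ e, s((orient e).1, (orient e).2) = e.1

namespace EdgeLabeling

variable {n : ℕ} {S : Type u}

/-- There is a (unique) morphism `μ ⟶ ν` iff on each edge either the orientations agree and the
label of `μ` is at most that of `ν`, or the orientations differ and the label of `μ` is strictly
smaller. -/
instance : PartialOrder (EdgeLabeling n S) where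
  le μ ν := ∀ e, (μ.orient e = ν.orient e ∧ μ.label e ≤ ν.label e) ∨
    (μ.orient e ≠ ν.orient e ∧ μ.label e < ν.label e)
  le_refl μ e := Or.inl ⟨rfl, le_rfl⟩
  le_trans μ ν ρ h₁ h₂ e := by
    by_cases h : μ.orient e = ρ.orient e
    · refine Or.inl ⟨h, ?_⟩
      rcases h₁ e with h₁ | h₁ <;> rcases h₂ e with h₂ | h₂ <;>
        first | exact h₁.2.trans h₂.2 | exact (h₁.2.trans_le h₂.2).le |
          exact (h₁.2.trans_lt h₂.2).le | exact (h₁.2.trans h₂.2).le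
    · refine Or.inr ⟨h, ?_⟩
      rcases h₁ e with h₁ | h₁ <;> rcases h₂ e with h₂ | h₂
      · exact absurd (h₁.1.trans h₂.1) h
      · exact h₁.2.trans_lt h₂.2
      · exact h₁.2.trans_le h₂.2
      · exact h₁.2.trans h₂.2
  le_antisymm μ ν h₁ h₂ := by
    have key : ∀ e, μ.orient e = ν.orient e ∧ μ.label e = ν.label e := fun e => by
      rcases h₁ e with h₁ | h₁ <;> rcases h₂ e with h₂ | h₂
      · exact ⟨h₁.1, le_antisymm h₁.2 h₂.2⟩
      · exact absurd h₁.1.symm h₂.1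
      · exact absurd h₂.1.symm h₁.1
      · exact absurd h₂.2 h₁.2.asymm
    exact EdgeLabeling.ext (funext fun e => (key e).2) (funext fun e => (key e).1)

/-- `x₁, …, x_k` (with `k = m + 2 ≥ 2`) is an oriented cycle in `μ` all of whose edges have the
label `i`: the `x_j` are distinct and each edge from `x_j` to its cyclic successor is oriented in
this direction and labelled `i`. Addition in `Fin (m + 2)` is cyclic. -/
def IsConstantCycle (μ : EdgeLabeling n S) (m : ℕ) (x : Fin (m + 2) → S) (i : Fin n) : Prop :=
  Function.Injective x ∧ ∀ j, ∃ e, μ.orient e = (x j, x (j + 1)) ∧ μ.label e = i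

/-- `μ` contains no oriented cycle with constant label on the edges. -/
def NoConstantCycle (μ : EdgeLabeling n S) : Prop :=
  ∀ (m : ℕ) (x : Fin (m + 2) → S) (i : Fin n), ¬ μ.IsConstantCycle m x i

end EdgeLabeling

/-- The partially ordered set `𝒦ₙᵉ(S)` (the extended complete graph operad in arity `S`), a full
subcategory of `𝒢ₙ(S)`. -/
abbrev ExtendedCompleteGraph (n : ℕ) (S : Type u) : Type u :=
  {μ : EdgeLabeling n S // μ.NoConstantCycle}

/-! ## Little cubes -/

/-- The space `𝒞ₙ(1)` of little `n`-cubes: the `n`-tuples of pairs of endpoints `0 ≤ a < b ≤ 1`,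
with the subspace topology from `(I × I)ⁿ`. -/
abbrev LittleCube (n : ℕ) : Type :=
  {c : Fin n → unitInterval × unitInterval // ∀ i, (c i).1 < (c i).2}

namespace LittleCube

variable {n : ℕ}

/-- The affine map given by a little cube, `f_i(t) = (1 - t) a_i + t b_i` in each coordinate. -/
def toMap (c : LittleCube n) (t : Fin n → ℝ) : Fin n → ℝ :=
  fun i => (1 - t i) * ((c.1 i).1 : ℝ) + t i * ((c.1 i).2 : ℝ)

/-- The image `c(int Iⁿ)` of the interior of the unit cube. -/
def openImage (c : LittleCube n) : Set (Fin n → ℝ) :=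
  c.toMap '' interior (Set.Icc 0 1)

/-- `c <ᵢ d`: the `i`-th interval of `c` ends before that of `d` begins, `f_i(1) ≤ g_i(0)`. -/
def Before (i : Fin n) (c d : LittleCube n) : Prop :=
  (c.1 i).2 ≤ (d.1 i).1

end LittleCube

/-- The space `𝒞ₙ(S)` of `S`-indexed little `n`-cubes with separated interiors, a subspace of
`𝒞ₙ(1)^S`. -/
abbrev LittleCubes (n : ℕ) (S : Type u) : Type u :=
  {c : S → LittleCube n // ∀ x y, x ≠ y → Disjoint (c x).openImage (c y).openImage}

/-- The subspace `G(μ)` of `𝒞ₙ(S)`: for each edge, with orientation `(x, y)` and label `i` in `μ`,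
the cubes satisfy `c_x <ᵢ c_y`. -/
def cubeCell {n : ℕ} {S : Type u} (μ : EdgeLabeling n S) : Set (LittleCubes n S) :=
  {c | ∀ e, LittleCube.Before (μ.label e) (c.1 (μ.orient e).1) (c.1 (μ.orient e).2)}

/-- `F(ν)`, the union of the `G(μ)` over all `μ ⟶ ν` in `𝒦ₙᵉ(S)`. -/
def cubeUnion {n : ℕ} {S : Type u} (ν : ExtendedCompleteGraph n S) : Set (LittleCubes n S) :=
  ⋃ (μ : ExtendedCompleteGraph n S) (_ : μ ≤ ν), cubeCell μ.1

theorem cubeUnion_mono {n : ℕ} {S : Type u} : Monotone (cubeUnion (n := n) (S := S)) :=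
  fun _ _ h => Set.iUnion₂_subset fun μ hμ =>
    Set.subset_iUnion₂ (s := fun (μ : ExtendedCompleteGraph n S) (_ : μ ≤ _) => cubeCell μ.1)
      μ (hμ.trans h)

/-! ## The category of compactly generated weak Hausdorff spaces -/

/-- A space is weak Hausdorff if every continuous map into it from a compact Hausdorff space has
closed image. -/
def IsWeakHausdorff (X : Type u) [TopologicalSpace X] : Prop :=
  ∀ (K : Type u) [TopologicalSpace K] [CompactSpace K] [T2Space K] (f : K → X),
    Continuous f → IsClosed (Set.range f)

/-- The property of being compactly generated and weak Hausdorff. -/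
def isCGWH : ObjectProperty TopCat.{u} :=
  fun X => CompactlyGeneratedSpace X ∧ IsWeakHausdorff X

/-- The category of compactly generated weak Hausdorff spaces and continuous maps. -/
abbrev CGWH : Type (u + 1) := isCGWH.{u}.FullSubcategory

namespace CGWH

/-- A first countable Hausdorff space, as an object of `CGWH`. -/
def of (X : Type u) [TopologicalSpace X] [FirstCountableTopology X] [T2Space X] : CGWH.{u} where
  obj := TopCat.of X
  property := ⟨inferInstanceAs (CompactlyGeneratedSpace X),
    fun _ _ _ _ _ hf => (isCompact_range hf).isClosed⟩

/-- A continuous map between first countable Hausdorff spaces, as a morphism of `CGWH`. -/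
def ofHom {X Y : Type u} [TopologicalSpace X] [FirstCountableTopology X] [T2Space X]
    [TopologicalSpace Y] [FirstCountableTopology Y] [T2Space Y] (f : C(X, Y)) : of X ⟶ of Y :=
  ObjectProperty.homMk (TopCat.ofHom f)

/-- The continuous map underlying a morphism of `CGWH`. -/
def toContinuousMap {X Y : CGWH.{u}} (f : X ⟶ Y) : C(X.obj, Y.obj) := f.hom.hom

end CGWH

/-! ## Reedy cofibrant diagrams -/

/-- A cofibration: a map with the homotopy extension property with respect to all spaces. -/
def HasHomotopyExtension {A X : Type u} [TopologicalSpace A] [TopologicalSpace X]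
    (f : C(A, X)) : Prop :=
  ∀ (Y : Type u) [TopologicalSpace Y] (g : C(X, Y)) (H : C(A × unitInterval, Y)),
    (∀ a, H (a, 0) = g (f a)) →
      ∃ K : C(X × unitInterval, Y), (∀ x, K (x, 0) = g x) ∧ ∀ a t, K (f a, t) = H (a, t)

section Reedy

variable {A : Type u} [PartialOrder A]

/-- The restriction of a diagram on a partially ordered set to the category `∂(A ↓ a)`, i.e. the
overcategory of `a` without its terminal object. As `A` is a partially ordered set, this is the
partially ordered set of all `b < a`. -/
def latchingDiagram (F : A ⥤ CGWH.{u}) (a : A) : Set.Iio a ⥤ CGWH.{u} :=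
  (Subtype.mono_coe (· ∈ Set.Iio a)).functor ⋙ F

/-- The maps `F(b) ⟶ F(a)` for `b < a`. -/
def latchingCocone (F : A ⥤ CGWH.{u}) (a : A) : Cocone (latchingDiagram F a) where
  pt := F.obj a
  ι :=
    { app := fun b => F.map (homOfLE (le_of_lt b.2))
      naturality := fun b c f => by
        simp only [Functor.const_obj_obj, Functor.const_obj_map]
        exact (F.map_comp _ _).symm.trans (congrArg F.map (Subsingleton.elim _ _)) }

/-- A diagram is Reedy cofibrant if for each `a` the canonical map from the colimit (which exists)
of its restriction to `∂(A ↓ a)` to `F(a)` is a cofibration. -/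
def IsReedyCofibrant (F : A ⥤ CGWH.{u}) : Prop :=
  ∀ a, ∃ _ : HasColimit (latchingDiagram F a),
    HasHomotopyExtension
      (CGWH.toContinuousMap (colimit.desc (latchingDiagram F a) (latchingCocone F a)))

end Reedy

/-! ## The diagram of unions of cells -/

instance {n : ℕ} {S : Type u} [Finite S] : FirstCountableTopology (LittleCubes n S) :=
  have : FirstCountableTopology (LittleCube n) :=
    Topology.IsInducing.subtypeVal.firstCountableTopology
  Topology.IsInducing.subtypeVal.firstCountableTopology

/-- The diagram `F : 𝒦ₙᵉ(S) ⥤ Top`, `ν ↦ F(ν)`, with the subspace inclusions as structure maps. -/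
def cubeDiagram (n : ℕ) (S : Type u) [Finite S] : ExtendedCompleteGraph n S ⥤ CGWH.{u} where
  obj ν := CGWH.of (cubeUnion ν)
  map f := CGWH.ofHom
    ⟨Set.inclusion (cubeUnion_mono (leOfHom f)), continuous_inclusion (cubeUnion_mono (leOfHom f))⟩

/-- The subspace inclusions `F(ν) ⟶ 𝒞ₙ(S)`. -/
def cubeCocone (n : ℕ) (S : Type u) [Finite S] : Cocone (cubeDiagram n S) where
  pt := CGWH.of (LittleCubes n S)
  ι := { app := fun ν => CGWH.ofHom ⟨fun c : cubeUnion ν => c.1, continuous_subtype_val⟩ }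

/-! Two cubes with disjoint interiors have a least separating coordinate, and in that coordinate
only one order is possible. Choosing these on all edges gives a least cell `G(μ)` through any
family; a family in `G(μ)` rules out constant cycles, since positions strictly increase along them.
Hence each family has a least `ν` with the family in `F(ν)` (`exists_least_cubeUnion`).

The `F(ν)` are finitely many closed subsets, so by `CGWH.isColimit_of_isClosedEmbedding` the
colimits of `F` over all indices and over `μ < ν` are the corresponding unions with the subspace
topology: least indices make glued maps well defined, and finite closed covers make them continuous.
This gives part 2.

For part 1 it remains to extend homotopies from the union of the `F(μ)`, `μ < ν`, to `F(ν)`.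
Shrinking all cubes towards their centres preserves every cell, and the time of entry into the
smaller union is continuous, being a minimum of maxima of explicit separation times
(`exists_entryTime`). One follows the shrinking until entry, then runs the given homotopy
(`HasHomotopyExtension.of_hittingTime`). -/

/-! ## Colimits of finite diagrams of closed subspaces -/

/-- A cocone of closed embeddings over a finite diagram in `CGWH` is a colimit if each point of its
apex has an initial lift to the diagram. -/
theorem CGWH.isColimit_of_isClosedEmbedding {J : Type u} [PartialOrder J] [Finite J]
    (D : J ⥤ CGWH.{u}) (c : Cocone D)
    (hc : ∀ j, Topology.IsClosedEmbedding (CGWH.toContinuousMap (c.ι.app j)))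
    (hx : ∀ x : c.pt.obj, ∃ (j : J) (y : (D.obj j).obj), CGWH.toContinuousMap (c.ι.app j) y = x ∧
      ∀ (k : J) (z : (D.obj k).obj), CGWH.toContinuousMap (c.ι.app k) z = x →
        ∃ f : j ⟶ k, CGWH.toContinuousMap (D.map f) y = z) :
    Nonempty (IsColimit c) := by
  choose j y hy hlift using hx
  let d (s : Cocone D) (x : c.pt.obj) : s.pt.obj := CGWH.toContinuousMap (s.ι.app (j x)) (y x)
  -- Every lift of a point is the image of its initial lift, so the value prescribed by `s` is the
  -- same for all lifts.
  have hd (s : Cocone D) (k : J) (z : (D.obj k).obj) :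
      d s (CGWH.toContinuousMap (c.ι.app k) z) = CGWH.toContinuousMap (s.ι.app k) z := by
    obtain ⟨f, hf⟩ := hlift _ k z rfl
    have hw := congrArg (fun g => CGWH.toContinuousMap g
      (y (CGWH.toContinuousMap (c.ι.app k) z))) (s.w f)
    exact hw.symm.trans (congrArg (CGWH.toContinuousMap (s.ι.app k)) hf)
  have hcont (s : Cocone D) : Continuous (d s) := by
    refine continuous_iff_isClosed.2 fun Z hZ => ?_
    have : d s ⁻¹' Z = ⋃ k, CGWH.toContinuousMap (c.ι.app k) ''
        (CGWH.toContinuousMap (s.ι.app k) ⁻¹' Z) := by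
      ext x
      simp only [Set.mem_preimage, Set.mem_iUnion, Set.mem_image]
      constructor
      · exact fun h => ⟨j x, y x, h, hy x⟩
      · rintro ⟨k, z, hz, rfl⟩
        rwa [hd]
    rw [this]
    exact isClosed_iUnion_of_finite fun k =>
      (hc k).isClosedMap _ (hZ.preimage (CGWH.toContinuousMap (s.ι.app k)).continuous)
  exact ⟨{
    desc := fun s => ObjectProperty.homMk (TopCat.ofHom ⟨d s, hcont s⟩)
    fac := fun s k => by
      apply ObjectProperty.hom_ext
      ext z
      exact hd s k z
    uniq := fun s m hm => by
      apply ObjectProperty.hom_ext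
      ext x
      have hw := congrArg (fun g => CGWH.toContinuousMap g (y x)) (hm (j x))
      have : CGWH.toContinuousMap m (CGWH.toContinuousMap (c.ι.app (j x)) (y x)) = d s x := hw
      rw [hy] at this
      exact this }⟩

/-- Isomorphisms in `CGWH` are homeomorphisms. -/
theorem CGWH.isHomeomorph_of_iso {X Y : CGWH.{u}} (e : X ≅ Y) :
    IsHomeomorph (CGWH.toContinuousMap e.hom) := by
  let h : X.obj ≃ₜ Y.obj := TopCat.homeoOfIso ((isCGWH.{u}.ι).mapIso e)
  exact h.isHomeomorph

/-! ## Homotopy extension -/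

/-- The homotopy extension property does not change under composition with a homeomorphism. -/
theorem HasHomotopyExtension.comp_isHomeomorph {A B X : Type u} [TopologicalSpace A]
    [TopologicalSpace B] [TopologicalSpace X] {f : C(B, X)} (hf : HasHomotopyExtension f)
    {e : C(A, B)} (he : IsHomeomorph e) : HasHomotopyExtension (f.comp e) := by
  intro Y _ g H hH
  let h : A ≃ₜ B := he.homeomorph
  obtain ⟨K, hK0, hK⟩ := hf Y g (H.comp ⟨fun p => (h.symm p.1, p.2), by fun_prop⟩) fun b => by
    have := hH (h.symm b)
    simp only [ContinuousMap.comp_apply] at this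
    rw [show e (h.symm b) = b from h.apply_symm_apply b] at this
    exact this
  refine ⟨K, hK0, fun a t => ?_⟩
  have := hK (e a) t
  simp only [ContinuousMap.comp_apply, ContinuousMap.coe_mk] at this
  rw [show h.symm (e a) = a from h.symm_apply_apply a] at this
  exact this

/-- An embedding `f` is a cofibration if a homotopy `σ` of the identity carries each point into
the image of `f` at a continuous time `u`, which vanishes on that image. -/
theorem HasHomotopyExtension.of_hittingTime {A X : Type u} [TopologicalSpace A]
    [TopologicalSpace X] (f : C(A, X)) (hf : Topology.IsEmbedding f) (σ : C(X × unitInterval, X))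
    (hσ : ∀ x, σ (x, 0) = x) (u : X → ℝ) (hu : Continuous u) (hu0 : ∀ x, 0 ≤ u x)
    (huA : ∀ a, u (f a) = 0)
    (hhit : ∀ x (t : unitInterval), u x = t → σ (x, t) ∈ Set.range f) :
    HasHomotopyExtension f := by
  intro Y _ g H hH
  -- `C` is the closed region after the hit, `C'` the one before it. On `C` the map `H` starts at
  -- the landing point `r` with its clock delayed by `u`; on the overlap the delayed time is `0`,
  -- where `H` agrees with `g`.
  let C : Set (X × unitInterval) := {p | u p.1 ≤ p.2}
  let C' : Set (X × unitInterval) := {p | (p.2 : ℝ) ≤ u p.1}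
  have hC : IsClosed C := isClosed_le (by fun_prop) (by fun_prop)
  have hC' : IsClosed C' := isClosed_le (by fun_prop) (by fun_prop)
  let τ (p : C) : unitInterval := ⟨u p.1.1, hu0 _, p.2.trans p.1.2.2.2⟩
  have hτ : Continuous τ := by fun_prop
  let δ (p : C) : unitInterval := ⟨p.1.2 - u p.1.1, sub_nonneg.2 p.2,
    (sub_le_self _ (hu0 _)).trans p.1.2.2.2⟩
  have hδ : Continuous δ := by fun_prop
  choose r hr using fun p : C => hhit p.1.1 (τ p) rfl
  have hrc : Continuous r := by
    rw [hf.continuous_iff]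
    have : f ∘ r = fun p : C => σ (p.1.1, τ p) := funext hr
    rw [this]
    fun_prop
  classical
  let K : X × unitInterval → Y := fun p =>
    if h : p ∈ C then H (r ⟨p, h⟩, δ ⟨p, h⟩) else g (σ p)
  have hK1 : ∀ p : C, K p = H (r p, δ p) := fun p => dif_pos p.2
  have hK2 : ∀ p ∈ C', K p = g (σ p) := by
    intro p hp
    by_cases h : p ∈ C
    · have heq : u p.1 = p.2 := le_antisymm h hp
      have h1 : δ ⟨p, h⟩ = 0 := Subtype.ext (by simp [δ, heq])
      have h2 : τ ⟨p, h⟩ = p.2 := Subtype.ext heq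
      rw [hK1 ⟨p, h⟩, h1, hH, hr, h2]
    · exact dif_neg h
  have hKC : ContinuousOn K C := by
    rw [continuousOn_iff_continuous_domRestrict]
    have : C.domRestrict K = fun p : C => H (r p, δ p) := funext hK1
    rw [this]
    fun_prop
  have hKC' : ContinuousOn K C' :=
    ContinuousOn.congr (g.continuous.comp σ.continuous).continuousOn hK2
  have hKc : Continuous K := by
    have hcover : C ∪ C' = Set.univ := Set.eq_univ_of_forall fun p => le_total (u p.1) (p.2 : ℝ)
    rw [← continuousOn_univ, ← hcover]
    exact hKC.union_of_isClosed hKC' hC hC'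
  refine ⟨⟨K, hKc⟩, fun x => ?_, fun a t => ?_⟩
  · exact (hK2 (x, 0) (by simpa [C'] using hu0 x)).trans (by rw [hσ])
  · have hmem : (f a, t) ∈ C := by simpa [C, huA] using t.2.1
    have h1 : δ ⟨(f a, t), hmem⟩ = t := Subtype.ext (by simp [δ, huA])
    have h2 : τ ⟨(f a, t), hmem⟩ = 0 := Subtype.ext (by simp [τ, huA])
    have h3 : r ⟨(f a, t), hmem⟩ = a := hf.injective (by rw [hr, h2, hσ])
    exact (hK1 ⟨(f a, t), hmem⟩).trans (by rw [h1, h3])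

/-! ## Little cubes -/

namespace LittleCube

variable {n : ℕ}

theorem openImage_eq (c : LittleCube n) :
    c.openImage = {p | ∀ i, ((c.1 i).1 : ℝ) < p i ∧ p i < ((c.1 i).2 : ℝ)} := by
  have hint : interior (Set.Icc (0 : Fin n → ℝ) 1) = {t | ∀ i, 0 < t i ∧ t i < 1} := by
    rw [← Set.pi_univ_Icc, interior_pi_set Set.finite_univ]
    ext t
    simp
  ext p
  rw [openImage, hint]
  constructor
  · rintro ⟨t, ht, rfl⟩ i
    have hw : ((c.1 i).1 : ℝ) < (c.1 i).2 := c.2 i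
    obtain ⟨h0, h1⟩ := ht i
    simp only [toMap]
    constructor <;> nlinarith
  · intro hp
    refine ⟨fun i => (p i - (c.1 i).1) / ((c.1 i).2 - (c.1 i).1), fun i => ?_, funext fun i => ?_⟩
    all_goals have hw : (0 : ℝ) < (c.1 i).2 - (c.1 i).1 := sub_pos.2 (c.2 i)
    · obtain ⟨h0, h1⟩ := hp i
      exact ⟨div_pos (sub_pos.2 h0) hw, (div_lt_one hw).2 (by linarith)⟩
    · simp only [toMap]
      field_simp
      ring

/-- Cubes with disjoint interiors are separated in some coordinate. -/
theorem exists_before_of_disjoint {c d : LittleCube n} (h : Disjoint c.openImage d.openImage) :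
    ∃ i, Before i c d ∨ Before i d c := by
  by_contra! hcon
  rw [openImage_eq, openImage_eq, Set.disjoint_left] at h
  -- With no separating coordinate the open intervals overlap in every coordinate, and a point
  -- chosen coordinatewise lies in both interiors.
  have hlt : ∀ i, max ((c.1 i).1 : ℝ) (d.1 i).1 < min ((c.1 i).2 : ℝ) (d.1 i).2 := fun i =>
    max_lt (lt_min (c.2 i) (not_le.1 (hcon i).2)) (lt_min (not_le.1 (hcon i).1) (d.2 i))
  choose p hp using fun i => exists_between (hlt i)
  exact h (a := p)
    (fun i => ⟨(le_max_left _ _).trans_lt (hp i).1, (hp i).2.trans_le (min_le_left _ _)⟩)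
    (fun i => ⟨(le_max_right _ _).trans_lt (hp i).1, (hp i).2.trans_le (min_le_right _ _)⟩)

theorem Before.trans {i : Fin n} {c d e : LittleCube n} (h : Before i c d) (h' : Before i d e) :
    Before i c e :=
  le_trans (b := (d.1 i).1) h (le_trans (d.2 i).le h')

theorem not_before_self (i : Fin n) (c : LittleCube n) : ¬ Before i c c := not_le.2 (c.2 i)

/-- The cube with the same centre as `c` and with sides shortened by the factor `1 - t / 2`. -/
noncomputable def shrink (c : LittleCube n) (t : unitInterval) : LittleCube n :=
  ⟨fun i =>
    -- Each end moves inwards by at most a quarter of the side, so the cube stays nondegenerate even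
    -- at `t = 1`.
    (⟨(c.1 i).1 + t / 4 * ((c.1 i).2 - (c.1 i).1), by
      have hw : ((c.1 i).1 : ℝ) < (c.1 i).2 := c.2 i
      constructor <;> nlinarith [t.2.1, t.2.2, (c.1 i).1.2.1, (c.1 i).2.2.2]⟩,
     ⟨(c.1 i).2 - t / 4 * ((c.1 i).2 - (c.1 i).1), by
      have hw : ((c.1 i).1 : ℝ) < (c.1 i).2 := c.2 i
      constructor <;> nlinarith [t.2.1, t.2.2, (c.1 i).1.2.1, (c.1 i).2.2.2]⟩),
   fun i => by
    have hw : ((c.1 i).1 : ℝ) < (c.1 i).2 := c.2 i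
    rw [← Subtype.coe_lt_coe]
    nlinarith [t.2.1, t.2.2]⟩

theorem continuous_lower (i : Fin n) : Continuous fun c : LittleCube n => (c.1 i).1 :=
  continuous_fst.comp ((continuous_apply i).comp continuous_subtype_val)

theorem continuous_upper (i : Fin n) : Continuous fun c : LittleCube n => (c.1 i).2 :=
  continuous_snd.comp ((continuous_apply i).comp continuous_subtype_val)

theorem continuous_shrink : Continuous fun p : LittleCube n × unitInterval => p.1.shrink p.2 := by
  refine Continuous.subtype_mk (continuous_pi fun i => ?_) _
  have ha := continuous_subtype_val.comp ((continuous_lower (n := n) i).comp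
    (continuous_fst (Y := unitInterval)))
  have hb := continuous_subtype_val.comp ((continuous_upper (n := n) i).comp
    (continuous_fst (Y := unitInterval)))
  have ht : Continuous fun p : LittleCube n × unitInterval => (p.2 : ℝ) / 4 := by fun_prop
  exact ((ha.add (ht.mul (hb.sub ha))).subtype_mk _).prodMk
    ((hb.sub (ht.mul (hb.sub ha))).subtype_mk _)

theorem shrink_zero (c : LittleCube n) : c.shrink 0 = c := by
  apply Subtype.ext
  funext i
  ext <;> simp [shrink]

theorem openImage_shrink_subset (c : LittleCube n) (t : unitInterval) :
    (c.shrink t).openImage ⊆ c.openImage := by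
  rw [openImage_eq, openImage_eq]
  intro p hp i
  have hw : ((c.1 i).1 : ℝ) < (c.1 i).2 := c.2 i
  have h := hp i
  simp only [shrink] at h
  constructor <;> nlinarith [t.2.1]

/-- The time at which `c` and `d`, when shrinking, become separated in the coordinate `i`. -/
noncomputable def separationTime (i : Fin n) (c d : LittleCube n) : ℝ :=
  -- The solution `t` of `b - t/4 * (b - a) = a' + t/4 * (b' - a')`; it may be negative or exceed
  -- `1`.
  4 * ((c.1 i).2 - (d.1 i).1) / (((c.1 i).2 - (c.1 i).1) + ((d.1 i).2 - (d.1 i).1))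

theorem continuous_separationTime (i : Fin n) :
    Continuous fun p : LittleCube n × LittleCube n => separationTime i p.1 p.2 := by
  have ha := continuous_subtype_val.comp (continuous_lower (n := n) i)
  have hb := continuous_subtype_val.comp (continuous_upper (n := n) i)
  have h1 := continuous_fst (X := LittleCube n) (Y := LittleCube n)
  have h2 := continuous_snd (X := LittleCube n) (Y := LittleCube n)
  refine Continuous.div (continuous_const.mul ((hb.comp h1).sub (ha.comp h2)))
    (((hb.comp h1).sub (ha.comp h1)).add ((hb.comp h2).sub (ha.comp h2))) fun p => ?_
  have h1 : ((p.1.1 i).1 : ℝ) < (p.1.1 i).2 := p.1.2 i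
  have h2 : ((p.2.1 i).1 : ℝ) < (p.2.1 i).2 := p.2.2 i
  exact (add_pos (sub_pos.2 h1) (sub_pos.2 h2)).ne'

/-- The gap between the two facing ends is affine in `t` with positive slope, so separation, once
reached, persists. -/
theorem before_shrink_iff {i : Fin n} {c d : LittleCube n} {t : unitInterval} :
    Before i (c.shrink t) (d.shrink t) ↔ separationTime i c d ≤ t := by
  have h1 : ((c.1 i).1 : ℝ) < (c.1 i).2 := c.2 i
  have h2 : ((d.1 i).1 : ℝ) < (d.1 i).2 := d.2 i
  rw [separationTime, div_le_iff₀ (add_pos (sub_pos.2 h1) (sub_pos.2 h2)), Before,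
    ← Subtype.coe_le_coe]
  simp only [shrink]
  constructor <;> intro h <;> nlinarith

end LittleCube

/-! ## Cells -/

section Cells

variable {n : ℕ} {S : Type u}

instance [Finite S] : Finite (EdgeLabeling n S) :=
  Finite.of_injective (fun μ : EdgeLabeling n S => (μ.label, μ.orient)) fun _ _ h =>
    EdgeLabeling.ext (congrArg Prod.fst h) (congrArg Prod.snd h)

/-- A labelling whose cell is not empty has no constant cycle. -/
theorem noConstantCycle_of_mem_cubeCell {μ : EdgeLabeling n S} {c : LittleCubes n S}
    (hc : c ∈ cubeCell μ) : μ.NoConstantCycle := by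
  rintro m x i ⟨-, hx⟩
  have hstep : ∀ j, LittleCube.Before i (c.1 (x j)) (c.1 (x (j + 1))) := fun j => by
    obtain ⟨e, he, rfl⟩ := hx j
    have := hc e
    rwa [he] at this
  -- Around the cycle the lower endpoints in coordinate `i` strictly increase, yet after `m + 2`
  -- steps the index returns to `0`.
  have hmono : StrictMono fun k : ℕ => ((c.1 (x (Fin.ofNat (m + 2) k))).1 i).1 :=
    strictMono_nat_of_lt_succ fun k => by
      have hk : Fin.ofNat (m + 2) (k + 1) = Fin.ofNat (m + 2) k + 1 := by
        ext; simp [Fin.val_add]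
      rw [hk]
      exact ((c.1 _).2 i).trans_le (hstep _)
  have h0 : Fin.ofNat (m + 2) (m + 2) = Fin.ofNat (m + 2) 0 := by ext; simp
  have hlt := hmono (show 0 < m + 2 by omega)
  simp only [h0] at hlt
  exact lt_irrefl _ hlt

/-- Each family of cubes lies in the cell of a least labelling. -/
theorem exists_least_cubeCell (c : LittleCubes n S) :
    ∃ μ : EdgeLabeling n S, c ∈ cubeCell μ ∧ ∀ ν, c ∈ cubeCell ν → μ ≤ ν := by
  have hsep : ∀ e : CompleteEdge S, ∃ i, ∃ p : S × S, s(p.1, p.2) = e.1 ∧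
      LittleCube.Before i (c.1 p.1) (c.1 p.2) := by
    rintro ⟨e, he⟩
    induction e using Sym2.ind with
    | _ x y =>
      rw [Sym2.mk_isDiag_iff] at he
      obtain ⟨i, hi | hi⟩ := LittleCube.exists_before_of_disjoint (c.2 x y he)
      · exact ⟨i, (x, y), rfl, hi⟩
      · exact ⟨i, (y, x), Sym2.eq_swap, hi⟩
  have hmin : ∀ e : CompleteEdge S, ∃ i, (∃ p : S × S, s(p.1, p.2) = e.1 ∧
      LittleCube.Before i (c.1 p.1) (c.1 p.2)) ∧ ∀ k, (∃ p : S × S, s(p.1, p.2) = e.1 ∧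
      LittleCube.Before k (c.1 p.1) (c.1 p.2)) → i ≤ k := fun e => by
    obtain ⟨i, hi, hle⟩ := WellFounded.has_min (wellFounded_lt (α := Fin n)) {i | ∃ p : S × S,
      s(p.1, p.2) = e.1 ∧ LittleCube.Before i (c.1 p.1) (c.1 p.2)} (hsep e)
    exact ⟨i, hi, fun k hk => not_lt.1 (hle k hk)⟩
  choose i hi hle using hmin
  choose p hp hbefore using hi
  refine ⟨⟨i, p, hp⟩, hbefore, fun ν hν e => ?_⟩
  have hle' : i e ≤ ν.label e := hle e _ ⟨ν.orient e, ν.orient_spec e, hν e⟩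
  by_cases h : p e = ν.orient e
  · exact Or.inl ⟨h, hle'⟩
  -- Opposite orientations with equal labels would put a cube before itself.
  · refine Or.inr ⟨h, hle'.lt_of_ne fun heq => ?_⟩
    have hνe := hν e
    rcases Sym2.eq_iff.1 ((hp e).trans (ν.orient_spec e).symm) with h' | h'
    · exact h (Prod.ext h'.1 h'.2)
    · rw [← h'.1, ← h'.2, ← heq] at hνe
      exact LittleCube.not_before_self _ _ ((hbefore e).trans hνe)

theorem cubeCell_subset_cubeUnion (μ : ExtendedCompleteGraph n S) :
    cubeCell μ.1 ⊆ cubeUnion μ :=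
  Set.subset_iUnion₂ (s := fun (κ : ExtendedCompleteGraph n S) (_ : κ ≤ μ) => cubeCell κ.1)
    μ le_rfl

/-- For each family of cubes there is a least `ν` with the family in `F(ν)`. -/
theorem exists_least_cubeUnion (c : LittleCubes n S) :
    ∃ μ : ExtendedCompleteGraph n S, c ∈ cubeUnion μ ∧ ∀ ν, c ∈ cubeUnion ν → μ ≤ ν := by
  obtain ⟨μ, hμ, hle⟩ := exists_least_cubeCell c
  refine ⟨⟨μ, noConstantCycle_of_mem_cubeCell hμ⟩, cubeCell_subset_cubeUnion _ hμ, fun ν hν => ?_⟩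
  obtain ⟨κ, hκ, hc⟩ := Set.mem_iUnion₂.1 hν
  exact le_trans (show _ ≤ κ from hle κ.1 hc) hκ

theorem isClosed_cubeCell (μ : EdgeLabeling n S) : IsClosed (cubeCell μ) := by
  simp only [cubeCell, LittleCube.Before, Set.ofPred_forall]
  have h : ∀ x, Continuous fun c : LittleCubes n S => c.1 x := fun x =>
    (continuous_apply x).comp continuous_subtype_val
  exact isClosed_iInter fun e => isClosed_le ((LittleCube.continuous_upper _).comp (h _))
    ((LittleCube.continuous_lower _).comp (h _))

theorem isClosed_cubeUnion [Finite S] (ν : ExtendedCompleteGraph n S) :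
    IsClosed (cubeUnion ν) :=
  isClosed_iUnion_of_finite fun μ => isClosed_iUnion_of_finite fun _ => isClosed_cubeCell μ.1

/-- The union of the `F(μ)` with `μ < ν`. -/
def cubeBoundary (ν : ExtendedCompleteGraph n S) : Set (LittleCubes n S) :=
  ⋃ μ : Set.Iio ν, cubeUnion μ.1

/-- Single cells suffice because everything below some `μ < ν` is again below `ν`; membership in one
cell is a condition on edges, so entry times become computable. -/
theorem mem_cubeBoundary_iff {ν : ExtendedCompleteGraph n S} {c : LittleCubes n S} :
    c ∈ cubeBoundary ν ↔ ∃ μ : Set.Iio ν, c ∈ cubeCell μ.1.1 := by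
  rw [cubeBoundary, Set.mem_iUnion]
  constructor
  · rintro ⟨μ, hμ⟩
    obtain ⟨κ, hκ, hc⟩ := Set.mem_iUnion₂.1 hμ
    exact ⟨⟨κ, hκ.trans_lt μ.2⟩, hc⟩
  · rintro ⟨μ, hμ⟩
    exact ⟨μ, cubeCell_subset_cubeUnion _ hμ⟩

theorem cubeBoundary_subset (ν : ExtendedCompleteGraph n S) : cubeBoundary ν ⊆ cubeUnion ν :=
  Set.iUnion_subset fun μ => cubeUnion_mono (le_of_lt μ.2)

/-! ### Shrinking and entry times. -/

/-- All cubes of a family shrink simultaneously. -/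
noncomputable def LittleCubes.shrink (c : LittleCubes n S) (t : unitInterval) : LittleCubes n S :=
  ⟨fun x => (c.1 x).shrink t, fun x y h => (c.2 x y h).mono
    (LittleCube.openImage_shrink_subset _ _) (LittleCube.openImage_shrink_subset _ _)⟩

theorem LittleCubes.continuous_shrink :
    Continuous fun p : LittleCubes n S × unitInterval => LittleCubes.shrink p.1 p.2 :=
  Continuous.subtype_mk (continuous_pi fun x => LittleCube.continuous_shrink.comp
    (((continuous_apply x).comp (continuous_subtype_val.comp continuous_fst)).prodMk
      continuous_snd)) _

theorem LittleCubes.shrink_zero (c : LittleCubes n S) : LittleCubes.shrink c 0 = c :=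
  Subtype.ext (funext fun _ => LittleCube.shrink_zero _)

theorem LittleCubes.shrink_mem_cubeCell_iff {c : LittleCubes n S} {t : unitInterval}
    {μ : EdgeLabeling n S} : LittleCubes.shrink c t ∈ cubeCell μ ↔ ∀ e,
      LittleCube.separationTime (μ.label e) (c.1 (μ.orient e).1) (c.1 (μ.orient e).2) ≤ t :=
  forall_congr' fun _ => LittleCube.before_shrink_iff

theorem LittleCubes.shrink_mem_cubeCell {c : LittleCubes n S} {μ : EdgeLabeling n S}
    (hc : c ∈ cubeCell μ) (t : unitInterval) : LittleCubes.shrink c t ∈ cubeCell μ := by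
  rw [← LittleCubes.shrink_zero c, LittleCubes.shrink_mem_cubeCell_iff] at hc
  exact LittleCubes.shrink_mem_cubeCell_iff.2 fun e => (hc e).trans t.2.1

theorem LittleCubes.shrink_mem_cubeUnion {c : LittleCubes n S} {ν : ExtendedCompleteGraph n S}
    (hc : c ∈ cubeUnion ν) (t : unitInterval) : LittleCubes.shrink c t ∈ cubeUnion ν := by
  obtain ⟨μ, hμ, hc⟩ := Set.mem_iUnion₂.1 hc
  exact Set.mem_iUnion₂.2 ⟨μ, hμ, LittleCubes.shrink_mem_cubeCell hc t⟩

/-- The time at which a shrinking family of cubes enters some cell `G(μ)` with `μ < ν`. -/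
theorem exists_entryTime [Finite S] (ν : ExtendedCompleteGraph n S) [Nonempty (Set.Iio ν)] :
    ∃ u : LittleCubes n S → NNReal, Continuous u ∧
      ∀ c (t : unitInterval), u c ≤ (t : ℝ) ↔ LittleCubes.shrink c t ∈ cubeBoundary ν := by
  have := Fintype.ofFinite (Set.Iio ν)
  have := Fintype.ofFinite (CompleteEdge S)
  -- Entering `G(μ)` requires all edges to be separated, hence a maximum; `NNReal` truncates
  -- negative times and gives `0` when there are no edges. Entering some cell is then a minimum over
  -- `μ`.
  let v (μ : Set.Iio ν) (c : LittleCubes n S) : NNReal :=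
    Finset.univ.sup fun e => Real.toNNReal (LittleCube.separationTime (μ.1.1.label e)
      (c.1 (μ.1.1.orient e).1) (c.1 (μ.1.1.orient e).2))
  have hv : ∀ μ, Continuous (v μ) := fun μ => Continuous.finset_sup_apply fun e _ =>
    continuous_real_toNNReal.comp ((LittleCube.continuous_separationTime _).comp
      (f := fun c : LittleCubes n S => (c.1 (μ.1.1.orient e).1, c.1 (μ.1.1.orient e).2))
      (((continuous_apply _).comp continuous_subtype_val).prodMk
        ((continuous_apply _).comp continuous_subtype_val)))
  refine ⟨fun c => Finset.univ.inf' Finset.univ_nonempty fun μ => v μ c,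
    Continuous.finset_inf'_apply Finset.univ_nonempty fun μ _ => hv μ, fun c t => ?_⟩
  have ht : ∀ x : NNReal, (x : ℝ) ≤ t ↔ x ≤ ⟨t, t.2.1⟩ := fun x => Iff.rfl
  rw [mem_cubeBoundary_iff, ht]
  refine (Finset.inf'_le_iff _).trans ?_
  simp only [Finset.mem_univ, true_and, LittleCubes.shrink_mem_cubeCell_iff]
  refine exists_congr fun μ => Finset.sup_le_iff.trans (forall_congr' fun e => ?_)
  exact (forall_prop_of_true (Finset.mem_univ e)).trans Real.toNNReal_le_iff_le_coe

/-- The inclusion of the union of all `F(μ)` with `μ < ν` into `F(ν)` is a cofibration. -/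
theorem hasHomotopyExtension_cubeBoundary [Finite S] (ν : ExtendedCompleteGraph n S) :
    HasHomotopyExtension (⟨Set.inclusion (cubeBoundary_subset ν),
      continuous_inclusion (cubeBoundary_subset ν)⟩ : C(cubeBoundary ν, cubeUnion ν)) := by
  -- For minimal `ν` there is no entry time, but the boundary is empty and the constant homotopy
  -- extends.
  rcases isEmpty_or_nonempty (Set.Iio ν) with hE | hE
  · intro Y _ g H _
    exact ⟨g.comp ContinuousMap.fst, fun _ => rfl, fun a =>
      (hE.false (mem_cubeBoundary_iff.1 a.2).choose).elim⟩
  · obtain ⟨u, hu, hmem⟩ := exists_entryTime ν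
    refine HasHomotopyExtension.of_hittingTime _ (Topology.IsEmbedding.inclusion (cubeBoundary_subset ν))
      ⟨fun p => ⟨LittleCubes.shrink p.1.1 p.2, LittleCubes.shrink_mem_cubeUnion p.1.2 p.2⟩, ?_⟩
      (fun x => Subtype.ext (LittleCubes.shrink_zero x.1)) (fun x => u x.1) (by fun_prop)
      (fun x => (u x.1).2) (fun a => ?_) fun x t h => ?_
    · exact Continuous.subtype_mk (LittleCubes.continuous_shrink.comp (f := fun p :
        cubeUnion ν × unitInterval => (p.1.1, p.2)) (by fun_prop)) _
    · have h := (hmem a.1 0).2 (by rw [LittleCubes.shrink_zero]; exact a.2)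
      exact le_antisymm h (u a.1).2
    · exact ⟨⟨_, (hmem x.1 t).1 h.le⟩, rfl⟩

/-! ### The colimits as unions. -/

/-- The inclusions of the `F(μ)` with `μ < ν` into their union. -/
def boundaryCocone [Finite S] (ν : ExtendedCompleteGraph n S) :
    Cocone (latchingDiagram (cubeDiagram n S) ν) where
  pt := CGWH.of (cubeBoundary ν)
  ι := { app := fun μ => CGWH.ofHom
          ⟨Set.inclusion (Set.subset_iUnion (fun μ : Set.Iio ν => cubeUnion μ.1) μ),
            continuous_inclusion (Set.subset_iUnion (fun μ : Set.Iio ν => cubeUnion μ.1) μ)⟩ }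

theorem nonempty_isColimit_boundaryCocone [Finite S] (ν : ExtendedCompleteGraph n S) :
    Nonempty (IsColimit (boundaryCocone ν)) := by
  refine CGWH.isColimit_of_isClosedEmbedding _ _ (fun μ => ?_) fun x => ?_
  · refine ⟨Topology.IsEmbedding.inclusion
      (Set.subset_iUnion (fun μ : Set.Iio ν => cubeUnion μ.1) μ), ?_⟩
    change IsClosed (Set.range (Set.inclusion
      (Set.subset_iUnion (fun μ : Set.Iio ν => cubeUnion μ.1) μ)))
    rw [Set.range_inclusion]
    exact (isClosed_cubeUnion μ.1).preimage continuous_subtype_val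
  · obtain ⟨μ, hμ, hle⟩ := exists_least_cubeUnion x.1
    obtain ⟨κ, hκ⟩ := Set.mem_iUnion.1 x.2
    -- The least index of a boundary point is below some `κ < ν`, so it lies in the indexing poset.
    refine ⟨⟨μ, (hle _ hκ).trans_lt κ.2⟩, ⟨x.1, hμ⟩, rfl, fun k z hz => ?_⟩
    have hzx : z.1 = x.1 := congrArg Subtype.val hz
    exact ⟨homOfLE (hle k.1 (hzx ▸ z.2)), Subtype.ext hzx.symm⟩

theorem nonempty_isColimit_cubeCocone (n : ℕ) (S : Type u) [Finite S] :
    Nonempty (IsColimit (cubeCocone n S)) := by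
  refine CGWH.isColimit_of_isClosedEmbedding _ _
    (fun μ => (isClosed_cubeUnion μ).isClosedEmbedding_subtypeVal) fun x => ?_
  obtain ⟨μ, hμ, hle⟩ := exists_least_cubeUnion x
  refine ⟨μ, ⟨x, hμ⟩, rfl, fun k z hz => ?_⟩
  have hzx : z.1 = x := hz
  exact ⟨homOfLE (hle k (hzx ▸ z.2)), Subtype.ext hzx.symm⟩

end Cells

theorem mainTheorem7 (n : ℕ) (hn : 1 ≤ n) (S : Type u) [Finite S] :
    IsReedyCofibrant (cubeDiagram n S) ∧
      ∃ _ : HasColimit (cubeDiagram n S),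
        IsHomeomorph (CGWH.toContinuousMap (colimit.desc (cubeDiagram n S) (cubeCocone n S))) := by
  refine ⟨fun ν => ?_, ?_⟩
  · obtain ⟨h⟩ := nonempty_isColimit_boundaryCocone ν
    have hcolim : HasColimit (latchingDiagram (cubeDiagram n S) ν) := ⟨⟨_, h⟩⟩
    refine ⟨hcolim, ?_⟩
    let e := (colimit.isColimit _).coconePointUniqueUpToIso h
    let i : (boundaryCocone ν).pt ⟶ (cubeDiagram n S).obj ν :=
      CGWH.ofHom ⟨Set.inclusion (cubeBoundary_subset ν), continuous_inclusion _⟩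
    -- The latching map is the boundary inclusion up to a homeomorphism of its domain.
    have hdesc : colimit.desc _ (latchingCocone (cubeDiagram n S) ν) = e.hom ≫ i := by
      refine colimit.hom_ext fun μ => (colimit.ι_desc _ μ).trans ?_
      exact (congrArg (· ≫ i)
        ((colimit.isColimit _).comp_coconePointUniqueUpToIso_hom h μ)).symm.trans
          (Category.assoc _ _ _)
    rw [hdesc]
    exact (hasHomotopyExtension_cubeBoundary ν).comp_isHomeomorph (CGWH.isHomeomorph_of_iso e)
  · obtain ⟨h⟩ := nonempty_isColimit_cubeCocone n S
    have hcolim : HasColimit (cubeDiagram n S) := ⟨⟨_, h⟩⟩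
    exact ⟨hcolim, CGWH.isHomeomorph_of_iso ((colimit.isColimit _).coconePointUniqueUpToIso h)⟩
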